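/- Let $R$ be a commutative Noetherian local ring with maximal ideal $\mathfrak m$ and residue field $k$. Assume that $R$ is not Gorenstein and that $\mathfrak m^2=0$. Let $M$ be a finitely generated $R$-module. For a map $\mathrm{H}$ from isomorphism classes of $R$-modules to $\mathbb Z\cup\{\pm\infty\}$, a reducing $\mathrm{H}$-sequence of $M$ of length $r\ge 0$ is a sequence $K_0,\dots,K_r$ of finitely generated $R$-modules with $K_0=M$ and $\mathrm{H}(K_r)<\infty$ such that for each $i=1,\dots,r$ there are positive integers $a_i,b_i,n_i$ and a short exact sequence $$0\to K_{i-1}^{\oplus a_i}\to K_i\to (\Omega^{n_i}K_{i-1})^{\oplus b_i}\to 0,$$ where $\Omega^n$ denotes the $n$-th syzygy in a minimal free resolution. Let $\mathrm{red}\text{-}\mathrm{H}(M)\in\mathbb N\cup\{\infty\}$ be the infimum of the $r\ge 0$ such that $M$ has a reducing $\mathrm{H}$-sequence of length $r$; in particular $\mathrm{red}\text{-}\mathrm{H}(M)=0$ if and only if $\mathrm{H}(M)<\infty$. Write $\mathrm{pd}$, $\mathrm{CI\text{-}dim}$ and $\mathrm{G\text{-}dim}$ for the projective, complete intersection and Gorenstein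 dimension. The following are equivalent: 1. $M\cong R^{\oplus\alpha}\oplus k^{\oplus\beta}$ for some integers $\alpha,\beta\ge 0$. 2. $\mathrm{red}\text{-}\mathrm{pd}(M)<\infty$. 3. $\mathrm{red}\text{-}\mathrm{pd}(M)\le 1$. 4. $\mathrm{red}\text{-}\mathrm{CI\text{-}dim}(M)<\infty$. 5. $\mathrm{red}\text{-}\mathrm{CI\text{-}dim}(M)\le 1$. 6. $\mathrm{red}\text{-}\mathrm{G\text{-}dim}(M)<\infty$. 7. $\mathrm{red}\text{-}\mathrm{G\text{-}dim}(M)\le 1$. -/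

import Mathlib

open CategoryTheory

universe u

namespace ReducingDim

/-- A commutative Noetherian local ring `R` is Gorenstein if it has finite injective dimension
as a module over itself. -/
def IsGorenstein (R : Type u) [CommRing R] : Prop :=
  injectiveDimension (ModuleCat.of R R) < ⊤

/-- A short exact sequence `0 → A → B → C → 0` of `R`-modules exists. -/
def ShortExactSeq (R : Type u) [CommRing R] (A B C : Type u)
    [AddCommGroup A] [Module R A] [AddCommGroup B] [Module R B]
    [AddCommGroup C] [Module R C] : Prop :=
  ∃ (f : A →ₗ[R] B) (g : B →ₗ[R] C),
    Function.Injective f ∧ Function.Exact f g ∧ Function.Surjective g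

/-- `N` is (isomorphic to) the first syzygy `Ω M` of `M` over the local ring `R`, i.e. the kernel
of a minimal free cover `R^m → M`; minimality means that the kernel is contained in
`𝔪 R^m`. -/
def IsFirstSyzygy (R : Type u) [CommRing R] [IsLocalRing R] (M N : ModuleCat.{u} R) : Prop :=
  ∃ (m : ℕ) (f : N →ₗ[R] (Fin m → R)) (g : (Fin m → R) →ₗ[R] M),
    Function.Injective f ∧ Function.Exact f g ∧ Function.Surjective g ∧
      LinearMap.ker g ≤ IsLocalRing.maximalIdeal R • (⊤ : Submodule R (Fin m → R))

/-- `N` is (isomorphic to) the `n`-th syzygy `Ωⁿ M` of `M` in a minimal free resolution. -/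
def IsSyzygy (R : Type u) [CommRing R] [IsLocalRing R] :
    ℕ → ModuleCat.{u} R → ModuleCat.{u} R → Prop
  | 0, M, N => Nonempty (M ≃ₗ[R] N)
  | n + 1, M, N => ∃ L : ModuleCat.{u} R, IsFirstSyzygy R M L ∧ IsSyzygy R n L N

/-- `M` is totally reflexive: it is finitely generated and reflexive, and
`Extⁱ(M, R) = 0 = Extⁱ(M*, R)` for all `i ≥ 1`. -/
structure IsTotallyReflexive (R : Type u) [CommRing R] (M : ModuleCat.{u} R) : Prop where
  finite : Module.Finite R M
  reflexive : Module.IsReflexive R M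
  ext_self : ∀ i : ℕ, 1 ≤ i → Subsingleton (Abelian.Ext M (ModuleCat.of R R) i)
  ext_dual : ∀ i : ℕ, 1 ≤ i →
    Subsingleton (Abelian.Ext (ModuleCat.of R (Module.Dual R M)) (ModuleCat.of R R) i)

/-- `M` has a resolution `0 → Gₙ → ⋯ → G₀ → M → 0` by totally reflexive modules. -/
def HasGResolution (R : Type u) [CommRing R] : ℕ → ModuleCat.{u} R → Prop
  | 0, M => IsTotallyReflexive R M
  | n + 1, M => ∃ N G : ModuleCat.{u} R,
      IsTotallyReflexive R G ∧ ShortExactSeq R N G M ∧ HasGResolution R n N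

open Classical in
/-- The Gorenstein dimension of a finitely generated module (`-∞` for the zero module, as for the
projective dimension). -/
noncomputable def gorensteinDimension (R : Type u) [CommRing R] (M : ModuleCat.{u} R) :
    WithBot ℕ∞ :=
  if Subsingleton M then ⊥
  else ((⨅ (n : ℕ) (_ : HasGResolution R n M), (n : ℕ∞) : ℕ∞) : WithBot ℕ∞)

/-- A quasi-deformation `R → S ← Q` of the local ring `R`: Noetherian local rings `S` and `Q`, a
flat local homomorphism `R → S`, and a surjective homomorphism `Q → S` whose kernel is
generated by a (possibly empty) `Q`-regular sequence. -/
structure QuasiDeformation (R : Type u) [CommRing R] where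
  S : Type u
  Q : Type u
  [commRingS : CommRing S]
  [commRingQ : CommRing Q]
  [localS : IsLocalRing S]
  [localQ : IsLocalRing Q]
  [noetherianS : IsNoetherianRing S]
  [noetherianQ : IsNoetherianRing Q]
  [algebra : Algebra R S]
  [flat : Module.Flat R S]
  [isLocalHom : IsLocalHom (algebraMap R S)]
  toS : Q →+* S
  surjective : Function.Surjective toS
  exists_regular : ∃ xs : List Q,
    RingTheory.Sequence.IsRegular Q xs ∧ RingHom.ker toS = Ideal.ofList xs

attribute [instance] QuasiDeformation.commRingS QuasiDeformation.commRingQ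
  QuasiDeformation.localS QuasiDeformation.localQ QuasiDeformation.noetherianS
  QuasiDeformation.noetherianQ QuasiDeformation.algebra QuasiDeformation.flat
  QuasiDeformation.isLocalHom

/-- The projective dimension over `Q` of an `S`-module. -/
noncomputable def QuasiDeformation.pd {R : Type u} [CommRing R] (D : QuasiDeformation R)
    (N : ModuleCat.{u} D.S) : WithBot ℕ∞ :=
  projectiveDimension ((ModuleCat.restrictScalars D.toS).obj N)

open Classical in
/-- The complete intersection dimension: the infimum of `pd_Q(S ⊗ M) - pd_Q(S)` over all
quasi-deformations `R → S ← Q` (`-∞` for the zero module). The second term is finite, so that the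
difference is at most `n` if and only if `pd_Q(S ⊗ M) ≤ n + pd_Q(S)`. -/
noncomputable def ciDimension (R : Type u) [CommRing R] (M : ModuleCat.{u} R) :
    WithBot ℕ∞ :=
  if Subsingleton M then ⊥
  else ((⨅ (n : ℕ) (_ : ∃ D : QuasiDeformation R,
      D.pd (ModuleCat.of D.S (TensorProduct R D.S M)) ≤
        (n : WithBot ℕ∞) + D.pd (ModuleCat.of D.S D.S)), (n : ℕ∞) : ℕ∞) : WithBot ℕ∞)

/-- `K₀, …, K_r` is a reducing `H`-sequence of `M`, for a homological invariant `H`: these are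
finitely generated modules, `K₀ = M`, `H(K_r) < ∞`, and for each `i` there are positive integers
`a, b, n` and a short exact sequence `0 → K_{i}^a → K_{i+1} → (Ωⁿ K_{i})^b → 0`. -/
structure IsReducingSequence (R : Type u) [CommRing R] [IsLocalRing R]
    (H : ModuleCat.{u} R → WithBot ℕ∞) (M : ModuleCat.{u} R) (r : ℕ)
    (K : Fin (r + 1) → ModuleCat.{u} R) : Prop where
  finite : ∀ i, Module.Finite R (K i)
  zero_eq : K 0 = M
  last_lt : H (K (Fin.last r)) < ⊤
  step : ∀ i : Fin r, ∃ a b n : ℕ, 0 < a ∧ 0 < b ∧ 0 < n ∧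
    ∃ N : ModuleCat.{u} R, IsSyzygy R n (K i.castSucc) N ∧
      ShortExactSeq R (Fin a → K i.castSucc) (K i.succ) (Fin b → N)

/-- The reducing invariant `red-H(M)`: the least `r` such that `M` has a reducing `H`-sequence
`K₀, …, K_r`, and `∞` if there is none. -/
noncomputable def reducing (R : Type u) [CommRing R] [IsLocalRing R]
    (H : ModuleCat.{u} R → WithBot ℕ∞) (M : ModuleCat.{u} R) : ℕ∞ :=
  ⨅ (r : ℕ) (_ : ∃ K : Fin (r + 1) → ModuleCat.{u} R, IsReducingSequence R H M r K), (r : ℕ∞)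

/-- The reducing projective dimension. -/
noncomputable def reducingPD (R : Type u) [CommRing R] [IsLocalRing R]
    (M : ModuleCat.{u} R) : ℕ∞ :=
  reducing R projectiveDimension M

/-- The reducing complete intersection dimension. -/
noncomputable def reducingCIDim (R : Type u) [CommRing R] [IsLocalRing R]
    (M : ModuleCat.{u} R) : ℕ∞ :=
  reducing R (ciDimension R) M

/-- The reducing Gorenstein dimension. -/
noncomputable def reducingGDim (R : Type u) [CommRing R] [IsLocalRing R]
    (M : ModuleCat.{u} R) : ℕ∞ :=
  reducing R (gorensteinDimension R) M

end ReducingDim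

/-! Put e = dim_k 𝔪. If e ≤ 1, Baer's criterion shows that `R` is self-injective, so non-Gorenstein
forces e ≥ 2. Three facts then give the theorem.

(a) A finitely generated `M` with finite pd, CI-dim or G-dim is free
(`exists_equiv_pi_of_ext_eventually_zero`). In each case some exact functor F makes Extⁱ(F M, Y)
vanish for i ≫ 0, while Extⁱ(F R, Y) is zero for i > c and cyclic, nonzero for i = c over a local
ring. If `M` is not free, its syzygy is k^s with s > 0, so Extⁱ(F k, Y) = 0 for i ≫ 0. The sequence
0 → k^e → R → k → 0 pushes this vanishing down to all i > c, and in degree c it makes Ext(F k, Y)^e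
a quotient of a cyclic module. As e ≥ 2, this forces Extᶜ(F k, Y) = 0, hence Extᶜ(F R, Y) = 0, a
contradiction. For pd and G-dim, F is the identity and Y = R; for CI-dim, F is S ⊗ - viewed over Q,
and Y = Q.

(b) Each K_{i-1} embeds in K_i, so a module with a finite reducing sequence embeds in a free module.
The property `HasLinearSocle` holds for free modules, passes to submodules, and forces R^α ⊕ k^β
(`HasLinearSocle.exists_equiv`).

(c) If M = R^α ⊕ k^β, then ΩM = 𝔪^β, and `shortExactSeq_of_equiv` is an explicit one-step reducing
sequence ending in a free module. -/

namespace ReducingDim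

open IsLocalRing Abelian

/-! ### Finite direct sums given by equations, hence stable under additive functors. -/

section FinitePower

variable {C : Type*} [Category* C] [Preadditive C]

/-- `X` is a direct sum of `n` copies of `T`. -/
def IsFinitePower (X T : C) (n : ℕ) : Prop :=
  ∃ (p : Fin n → (X ⟶ T)) (ι : Fin n → (T ⟶ X)), ∑ i, p i ≫ ι i = 𝟙 X ∧
    (∀ i, ι i ≫ p i = 𝟙 T) ∧ ∀ i j, i ≠ j → ι i ≫ p j = 0

lemma IsFinitePower.map {D : Type*} [Category* D] [Preadditive D] (F : C ⥤ D) [F.Additive]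
    {X T : C} {n : ℕ} (h : IsFinitePower X T n) : IsFinitePower (F.obj X) (F.obj T) n := by
  obtain ⟨p, ι, h₁, h₂, h₃⟩ := h
  refine ⟨fun i ↦ F.map (p i), fun i ↦ F.map (ι i), ?_, fun i ↦ ?_, fun i j hij ↦ ?_⟩
  · simp only [← F.map_comp, ← F.map_sum, h₁, F.map_id]
  · rw [← F.map_comp, h₂, F.map_id]
  · rw [← F.map_comp, h₃ i j hij, F.map_zero]

lemma IsFinitePower.of_iso {X X' T : C} {n : ℕ} (h : IsFinitePower X T n) (e : X ≅ X') :
    IsFinitePower X' T n := by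
  obtain ⟨p, ι, h₁, h₂, h₃⟩ := h
  refine ⟨fun i ↦ e.inv ≫ p i, fun i ↦ ι i ≫ e.hom, ?_, fun i ↦ ?_, fun i j hij ↦ ?_⟩
  · have : ∑ i, (e.inv ≫ p i) ≫ ι i ≫ e.hom = e.inv ≫ (∑ i, p i ≫ ι i) ≫ e.hom := by
      simp [Preadditive.sum_comp, Preadditive.comp_sum]
    rw [this, h₁]; simp
  · simp [h₂]
  · simp [h₃ i j hij]

lemma isFinitePower_pi (R : Type u) [CommRing R] (T : Type u) [AddCommGroup T] [Module R T]
    (n : ℕ) : IsFinitePower (ModuleCat.of R (Fin n → T)) (ModuleCat.of R T) n := by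
  refine ⟨fun i ↦ ModuleCat.ofHom (LinearMap.proj i),
    fun i ↦ ModuleCat.ofHom (LinearMap.single R (fun _ ↦ T) i), ?_, fun i ↦ ?_, fun i j hij ↦ ?_⟩
  · simp only [← ModuleCat.ofHom_comp]
    refine ModuleCat.hom_ext (LinearMap.ext fun x ↦ ?_)
    simp only [ModuleCat.hom_sum, ModuleCat.hom_ofHom, LinearMap.sum_apply]
    exact Finset.univ_sum_single x
  · ext x : 2
    simp
  · ext x : 2
    simp [hij.symm]

end FinitePower

/-! ### Ext of finite powers, and the Ext argument behind freeness. -/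

section Ext

universe w

variable {Q : Type*} [CommRing Q] {C : Type*} [Category* C] [Abelian C] [HasExt.{w} C]

lemma IsFinitePower.subsingleton_ext {X T Y : C} {n i : ℕ} (h : IsFinitePower X T n)
    (hT : Subsingleton (Ext T Y i)) : Subsingleton (Ext X Y i) := by
  obtain ⟨p, ι, h₁, -, -⟩ := h
  refine subsingleton_of_forall_eq 0 fun x ↦ ?_
  have : (Ext.mk₀ (∑ i, p i ≫ ι i)).comp x (zero_add i) = 0 := by
    rw [Ext.mk₀_sum, Ext.sum_comp]
    refine Finset.sum_eq_zero fun j _ ↦ ?_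
    rw [← Ext.mk₀_comp_mk₀_assoc, Subsingleton.elim ((Ext.mk₀ (ι j)).comp x (zero_add i)) 0,
      Ext.comp_zero]
  simpa [h₁] using this

lemma IsFinitePower.subsingleton_ext_of_pos {X T Y : C} {n i : ℕ} (h : IsFinitePower X T n)
    (hn : 0 < n) (hX : Subsingleton (Ext X Y i)) : Subsingleton (Ext T Y i) := by
  obtain ⟨p, ι, -, h₂, -⟩ := h
  refine subsingleton_of_forall_eq 0 fun x ↦ ?_
  have := Ext.mk₀_comp_mk₀_assoc (ι ⟨0, hn⟩) (p ⟨0, hn⟩) x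
  rw [h₂, Ext.mk₀_id_comp, Subsingleton.elim ((Ext.mk₀ (p ⟨0, hn⟩)).comp x (zero_add i)) 0,
    Ext.comp_zero] at this
  exact this.symm

/-- A module is cyclic if it is generated by one element. -/
def IsCyclicModule (Q E : Type*) [CommRing Q] [AddCommGroup E] [Module Q E] : Prop :=
  ∃ g : E, ∀ x : E, ∃ q : Q, x = q • g

variable [Linear Q C] [IsLocalRing Q]

/-- Over a local ring a power Eⁿ with n ≥ 2 is cyclic only if E = 0: a generator would have to
produce elements supported in a single coordinate. -/
lemma IsFinitePower.subsingleton_ext_of_isCyclic {X T Y : C} {n i : ℕ} (h : IsFinitePower X T n)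
    (hn : 2 ≤ n) (hX : IsCyclicModule Q (Ext X Y i)) : Subsingleton (Ext T Y i) := by
  obtain ⟨p, ι, -, h₂, h₃⟩ := h
  obtain ⟨g, hg⟩ := hX
  let a : Fin n := ⟨0, by omega⟩
  let b : Fin n := ⟨1, by omega⟩
  have hab : a ≠ b := by simp [a, b]
  have key (j : Fin n) (u : Ext T Y i) : ∃ q : Q, u = q • (Ext.mk₀ (ι j)).comp g (zero_add i) ∧
      ∀ l, l ≠ j → q • (Ext.mk₀ (ι l)).comp g (zero_add i) = 0 := by
    obtain ⟨q, hq⟩ := hg ((Ext.mk₀ (p j)).comp u (zero_add i))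
    refine ⟨q, ?_, fun l hl ↦ ?_⟩
    · rw [← Ext.comp_smul, ← hq, Ext.mk₀_comp_mk₀_assoc, h₂, Ext.mk₀_id_comp]
    · rw [← Ext.comp_smul, ← hq, Ext.mk₀_comp_mk₀_assoc, h₃ l j hl, Ext.mk₀_zero, Ext.zero_comp]
  refine subsingleton_of_forall_eq 0 fun u ↦ ?_
  -- Write g_a, g_b for two coordinates of the generator. Some q satisfies q g_a = g_a and q g_b =
  -- 0. Either q or 1 - q is a unit, so g_b or g_a vanishes; but each of them generates Ext(T, Y).
  obtain ⟨q, hq, hq'⟩ := key a ((Ext.mk₀ (ι a)).comp g (zero_add i))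
  rcases IsLocalRing.isUnit_or_isUnit_one_sub_self q with hu | hu
  · have hb := (hu.smul_eq_zero).1 (hq' b hab.symm)
    obtain ⟨r, hr, -⟩ := key b u
    rw [hr, hb, smul_zero]
  · have ha : (1 - q) • (Ext.mk₀ (ι a)).comp g (zero_add i) = 0 := by
      rw [sub_smul, one_smul, ← hq, sub_self]
    obtain ⟨r, hr, -⟩ := key a u
    rw [hr, (hu.smul_eq_zero).1 ha, smul_zero]

/-- `S₁` and `S₂` play the images of 0 → k^e → R → k → 0 and 0 → k^s → R^m → M → 0. The conclusion
contradicts the nonvanishing of Extᶜ of the image of R. -/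
lemma not_shortExact_of_ext_eventually_zero {S₁ S₂ : ShortComplex C} (h₁ : S₁.ShortExact)
    (h₂ : S₂.ShortExact) {Y : C} {e m s c N : ℕ} (he : 2 ≤ e) (hs : 0 < s)
    (hU : IsFinitePower S₁.X₁ S₁.X₃ e) (hV : IsFinitePower S₂.X₁ S₁.X₃ s)
    (hW : IsFinitePower S₂.X₂ S₁.X₂ m) (hA : ∀ i, c < i → Subsingleton (Ext S₁.X₂ Y i))
    (hc : IsCyclicModule Q (Ext S₁.X₂ Y c)) (hM : ∀ i, N ≤ i → Subsingleton (Ext S₂.X₃ Y i)) :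
    Subsingleton (Ext S₁.X₂ Y c) := by
  have hT (i : ℕ) (hi : c < i) (hi' : N ≤ i) : Subsingleton (Ext S₁.X₃ Y i) := by
    refine hV.subsingleton_ext_of_pos hs (subsingleton_of_forall_eq 0 fun x ↦ ?_)
    have := hM (1 + i) (by omega)
    have := hW.subsingleton_ext (hA i hi)
    obtain ⟨y, rfl⟩ := Ext.contravariant_sequence_exact₁ h₂ Y x rfl (Subsingleton.elim _ _)
    rw [Subsingleton.elim y 0, Ext.comp_zero]
  have step (i : ℕ) (hi : c < i) (h : Subsingleton (Ext S₁.X₃ Y (1 + i))) :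
      Subsingleton (Ext S₁.X₃ Y i) := by
    refine hU.subsingleton_ext_of_pos (by omega) (subsingleton_of_forall_eq 0 fun x ↦ ?_)
    have := hA i hi
    obtain ⟨y, rfl⟩ := Ext.contravariant_sequence_exact₁ h₁ Y x rfl (Subsingleton.elim _ _)
    rw [Subsingleton.elim y 0, Ext.comp_zero]
  -- Descent in the degree: d bounds how far i lies below the range in which vanishing is already
  -- known.
  have hT' (d : ℕ) : ∀ i, c < i → N ≤ i + d → Subsingleton (Ext S₁.X₃ Y i) := by
    induction d with
    | zero => exact fun i hi h ↦ hT i hi h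
    | succ d ih => exact fun i hi h ↦ step i hi (ih _ (by omega) (by omega))
  have hcT : Subsingleton (Ext S₁.X₃ Y (1 + c)) := hT' N _ (by omega) (by omega)
  have hsurj (x : Ext S₁.X₁ Y c) := Ext.contravariant_sequence_exact₁ h₁ Y x rfl
    (Subsingleton.elim _ _)
  -- Vanishing in degree c + 1 makes Extᶜ(X₂, Y) → Extᶜ(X₁, Y) surjective, so cyclicity passes to
  -- the e-fold power.
  have : Subsingleton (Ext S₁.X₃ Y c) := by
    obtain ⟨g, hg⟩ := hc
    refine hU.subsingleton_ext_of_isCyclic (Q := Q) he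
      ⟨(Ext.mk₀ S₁.f).comp g (zero_add c), fun x ↦ ?_⟩
    obtain ⟨y, rfl⟩ := hsurj x
    obtain ⟨q, rfl⟩ := hg y
    exact ⟨q, by rw [Ext.comp_smul]⟩
  have := hU.subsingleton_ext this
  refine subsingleton_of_forall_eq 0 fun x ↦ ?_
  obtain ⟨y, rfl⟩ := Ext.contravariant_sequence_exact₂ h₁ Y x (Subsingleton.elim _ _)
  rw [Subsingleton.elim y 0, Ext.comp_zero]

/-- The object `A` behaves with respect to `Ext(-, Y)` like a perfect module of grade `c`: the
groups `Extⁱ(A, Y)` vanish for `i > c`, and `Extᶜ(A, Y)` is cyclic and nonzero. -/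
structure IsExtCyclic (Q : Type*) [CommRing Q] [Linear Q C] (A Y : C) (c : ℕ) : Prop where
  subsingleton : ∀ i, c < i → Subsingleton (Ext A Y i)
  cyclic : IsCyclicModule Q (Ext A Y c)
  nontrivial : Nontrivial (Ext A Y c)

omit [IsLocalRing Q] in
lemma IsExtCyclic.of_iso {A B Y : C} {c : ℕ} (h : IsExtCyclic Q A Y c) (e : A ≅ B) :
    IsExtCyclic Q B Y c := by
  have key (i : ℕ) (x : Ext B Y i) : (Ext.mk₀ e.inv).comp
      ((Ext.mk₀ e.hom).comp x (zero_add i)) (zero_add i) = x := by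
    rw [Ext.mk₀_comp_mk₀_assoc, e.inv_hom_id, Ext.mk₀_id_comp]
  have key' (i : ℕ) (x : Ext A Y i) : (Ext.mk₀ e.hom).comp
      ((Ext.mk₀ e.inv).comp x (zero_add i)) (zero_add i) = x := by
    rw [Ext.mk₀_comp_mk₀_assoc, e.hom_inv_id, Ext.mk₀_id_comp]
  refine ⟨fun i hi ↦ subsingleton_of_forall_eq 0 fun x ↦ ?_, ?_, ?_⟩
  · have := h.subsingleton i hi
    rw [← key i x, Subsingleton.elim ((Ext.mk₀ e.hom).comp x (zero_add i)) 0, Ext.comp_zero]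
  · obtain ⟨g, hg⟩ := h.cyclic
    refine ⟨(Ext.mk₀ e.inv).comp g (zero_add c), fun x ↦ ?_⟩
    obtain ⟨q, hq⟩ := hg ((Ext.mk₀ e.hom).comp x (zero_add c))
    exact ⟨q, by rw [← Ext.comp_smul, ← hq, key]⟩
  · have := h.nontrivial
    have hinj : Function.Injective
        (fun x : Ext A Y c ↦ (Ext.mk₀ e.inv).comp x (zero_add c)) :=
      fun x y hxy ↦ by
        rw [← key' c x, ← key' c y]
        exact congrArg (fun z ↦ (Ext.mk₀ e.hom).comp z (zero_add c)) hxy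
    exact hinj.nontrivial

/-- Dividing by a regular element x of the maximal ideal raises the grade by one: the long exact
sequence gives a surjection from Extᶜ(X₁, Y) onto the new top Ext, which is nonzero by Nakayama. -/
lemma IsExtCyclic.of_shortExact {S : ShortComplex C} (hS : S.ShortExact) {Y : C} {c : ℕ}
    (h₁ : IsExtCyclic Q S.X₁ Y c) (h₂ : IsExtCyclic Q S.X₂ Y c) {x : Q}
    (hx : x ∈ IsLocalRing.maximalIdeal Q) (e : S.X₁ = S.X₂) (hf : S.f = x • eqToHom e) :
    IsExtCyclic Q S.X₃ Y (c + 1) := by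
  have hsurj (y : Ext S.X₃ Y (c + 1)) : ∃ z : Ext S.X₁ Y c,
      hS.extClass.comp z (add_comm 1 c) = y := by
    have := h₂.subsingleton (c + 1) (by omega)
    exact Ext.contravariant_sequence_exact₃ hS Y y (Subsingleton.elim _ _) _
  refine ⟨fun i hi ↦ subsingleton_of_forall_eq 0 fun y ↦ ?_, ?_, ?_⟩
  · have := h₂.subsingleton i (by omega)
    have := h₁.subsingleton (i - 1) (by omega)
    obtain ⟨z, rfl⟩ := Ext.contravariant_sequence_exact₃ hS Y y (Subsingleton.elim _ _)
      (n₀ := i - 1) (by omega)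
    rw [Subsingleton.elim z 0, Ext.comp_zero]
  · obtain ⟨g, hg⟩ := h₁.cyclic
    refine ⟨hS.extClass.comp g (add_comm 1 c), fun y ↦ ?_⟩
    obtain ⟨z, rfl⟩ := hsurj y
    obtain ⟨q, rfl⟩ := hg z
    exact ⟨q, by rw [Ext.comp_smul]⟩
  · by_contra hn
    rw [not_nontrivial_iff_subsingleton] at hn
    have := h₁.nontrivial
    obtain ⟨g, hg⟩ := h₁.cyclic
    obtain ⟨z, hz⟩ := Ext.contravariant_sequence_exact₁ hS Y g (add_comm 1 c)
      (Subsingleton.elim _ _)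
    rw [hf, Ext.mk₀_smul, Ext.smul_comp] at hz
    obtain ⟨q, hq⟩ := hg ((Ext.mk₀ (eqToHom e)).comp z (zero_add c))
    rw [hq, smul_smul] at hz
    -- If the new Ext were zero, multiplication by x would be surjective on Extᶜ, so the generator
    -- would satisfy g = x q g.
    have hu : IsUnit (1 - x * q) := by
      by_contra hu
      have h1 : (1 - x * q) + x * q ∈ IsLocalRing.maximalIdeal Q :=
        add_mem ((IsLocalRing.mem_maximalIdeal _).2 hu) (Ideal.mul_mem_right _ _ hx)
      rw [sub_add_cancel] at h1
      exact (Ideal.ne_top_iff_one _).1 (maximalIdeal.isMaximal Q).ne_top h1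
    have hg0 : g = 0 := by
      refine (hu.smul_eq_zero).1 ?_
      rw [sub_smul, one_smul, hz, sub_self]
    refine not_subsingleton (Ext S.X₁ Y c) (subsingleton_of_forall_eq 0 fun y ↦ ?_)
    obtain ⟨r, rfl⟩ := hg y
    rw [hg0, smul_zero]

end Ext

/-! ### Ext of quotients by regular sequences. -/

section RegularSequence

variable (Q : Type u) [CommRing Q] [IsLocalRing Q]

lemma isExtCyclic_self : IsExtCyclic Q (ModuleCat.of Q Q) (ModuleCat.of Q Q) 0 := by
  have hproj : Projective (ModuleCat.of Q Q) := inferInstance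
  refine ⟨fun i hi ↦ HasProjectiveDimensionLT.subsingleton (ModuleCat.of Q Q) 1 i hi _, ?_, ?_⟩
  · refine ⟨Ext.mk₀ (𝟙 _), fun x ↦ ?_⟩
    obtain ⟨f, rfl⟩ := (Ext.mk₀_bijective _ _).2 x
    refine ⟨f.hom 1, ?_⟩
    rw [← Ext.mk₀_smul]
    congr 1
    ext
    simp
  · refine ⟨0, Ext.mk₀ (𝟙 _), fun h ↦ ?_⟩
    rw [← Ext.mk₀_zero] at h
    have h' := congrArg (fun f : ModuleCat.of Q Q ⟶ ModuleCat.of Q Q ↦ f.hom (1 : Q))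
      ((Ext.mk₀_bijective _ _).1 h)
    exact zero_ne_one h'

variable {Q}

lemma IsExtCyclic.quotient {Y : ModuleCat.{u} Q} (xs : List Q)
    (hmem : ∀ x ∈ xs, x ∈ IsLocalRing.maximalIdeal Q) (N : ModuleCat.{u} Q) (c : ℕ)
    (h : IsExtCyclic Q N Y c) (hreg : RingTheory.Sequence.IsWeaklyRegular N xs) :
    ∃ d, IsExtCyclic Q (ModuleCat.of Q (N ⧸ (Ideal.ofList xs • (⊤ : Submodule Q N)))) Y d := by
  induction xs generalizing N c with
  | nil =>
    refine ⟨c, h.of_iso (LinearEquiv.toModuleIso ?_)⟩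
    exact (Submodule.quotEquivOfEqBot (Ideal.ofList ([] : List Q) • (⊤ : Submodule Q N))
      (by rw [Ideal.ofList_nil, Submodule.bot_smul])).symm
  | cons x xs ih =>
    rw [RingTheory.Sequence.isWeaklyRegular_cons_iff] at hreg
    have hS : (N.smulShortComplex x).ShortExact := hreg.1.smulShortComplex_shortExact
    have h' : IsExtCyclic Q (ModuleCat.of Q (QuotSMulTop x N)) Y (c + 1) :=
      IsExtCyclic.of_shortExact hS h h (hmem x (by simp)) rfl rfl
    obtain ⟨d, hd⟩ := ih (fun y hy ↦ hmem y (by simp [hy])) _ _ h' hreg.2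
    exact ⟨d, hd.of_iso (LinearEquiv.toModuleIso
      (Submodule.quotOfListConsSMulTopEquivQuotSMulTopInner N x xs).symm)⟩

end RegularSequence

/-! ### Residue field vector spaces and minimal covers over a local ring. -/

section Modules

variable {R : Type u} [CommRing R] [IsLocalRing R]

lemma exists_equiv_residueField (V : Type*) [AddCommGroup V] [Module R V] [Module.Finite R V]
    (h : ∀ r ∈ maximalIdeal R, ∀ v : V, r • v = 0) :
    ∃ s : ℕ, Nonempty (V ≃ₗ[R] (Fin s → ResidueField R)) := by
  have ht : Module.IsTorsionBySet R V (maximalIdeal R) := fun v a ↦ h a a.2 v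
  let : Module (ResidueField R) V := ht.module
  have : IsScalarTower R (ResidueField R) V := ht.isScalarTower
  have : Module.Finite (ResidueField R) V := Module.Finite.of_restrictScalars_finite R _ _
  exact ⟨_, ⟨(Module.finBasis (ResidueField R) V).equivFun.restrictScalars R⟩⟩

lemma isSemisimpleModule_of_smul_eq_zero (V : Type*) [AddCommGroup V] [Module R V]
    [Module.Finite R V] (h : ∀ r ∈ maximalIdeal R, ∀ v : V, r • v = 0) :
    IsSemisimpleModule R V := by
  obtain ⟨s, ⟨φ⟩⟩ := exists_equiv_residueField V h
  have : IsSimpleModule R (ResidueField R) :=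
    isSimpleModule_iff_quot_maximal.2
      ⟨maximalIdeal R, inferInstance, ⟨LinearEquiv.refl R (R ⧸ maximalIdeal R)⟩⟩
  exact IsSemisimpleModule.congr φ

/-- The coordinatewise reduction `Rⁿ → kⁿ`. -/
noncomputable def residuePi (R : Type u) [CommRing R] [IsLocalRing R] (n : ℕ) :
    (Fin n → R) →ₗ[R] (Fin n → ResidueField R) :=
  LinearMap.pi fun i ↦ (Algebra.linearMap R (ResidueField R)) ∘ₗ LinearMap.proj i

lemma residuePi_surjective (n : ℕ) : Function.Surjective (residuePi R n) := fun v ↦ by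
  choose r hr using fun i ↦ residue_surjective (v i)
  exact ⟨r, funext hr⟩

lemma residuePi_eq_zero_iff {n : ℕ} (r : Fin n → R) :
    residuePi R n r = 0 ↔ ∀ i, r i ∈ maximalIdeal R := by
  simp only [← residue_eq_zero_iff]
  exact funext_iff

/-- Lifts a k-basis of M/W to M. With W = 𝔪M this yields a minimal cover; with W the socle it yields
the free summand of M. -/
lemma exists_map_to_quotient_basis {M : Type*} [AddCommGroup M] [Module R M] [Module.Finite R M]
    (W : Submodule R M) (hW : ∀ r ∈ maximalIdeal R, ∀ x : M, r • x ∈ W) :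
    ∃ (n : ℕ) (g : (Fin n → R) →ₗ[R] M), LinearMap.range g ⊔ W = ⊤ ∧
      ∀ r, g r ∈ W ↔ ∀ i, r i ∈ maximalIdeal R := by
  obtain ⟨n, ⟨φ⟩⟩ := exists_equiv_residueField (R := R) (M ⧸ W) fun r hr v ↦ by
    obtain ⟨x, rfl⟩ := W.mkQ_surjective v
    rw [← map_smul]
    exact (Submodule.Quotient.mk_eq_zero _).2 (hW r hr x)
  obtain ⟨g, hg⟩ := Module.projective_lifting_property W.mkQ
    (φ.symm.toLinearMap ∘ₗ residuePi R n) W.mkQ_surjective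
  have hg' (r) : W.mkQ (g r) = φ.symm (residuePi R n r) := LinearMap.congr_fun hg r
  refine ⟨n, g, ?_, fun r ↦ ?_⟩
  · refine eq_top_iff.2 fun x _ ↦ ?_
    obtain ⟨r, hr⟩ := residuePi_surjective n (φ (W.mkQ x))
    have : x - g r ∈ W := by
      rw [← Submodule.Quotient.mk_eq_zero, ← Submodule.mkQ_apply, map_sub, hg', hr]
      simp
    exact Submodule.mem_sup.2 ⟨g r, ⟨r, rfl⟩, _, this, by abel⟩
  · rw [← residuePi_eq_zero_iff, ← Submodule.Quotient.mk_eq_zero, ← Submodule.mkQ_apply, hg']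
    simp

lemma exists_minimal_cover (M : Type*) [AddCommGroup M] [Module R M] [Module.Finite R M] :
    ∃ (n : ℕ) (g : (Fin n → R) →ₗ[R] M), Function.Surjective g ∧
      ∀ r, g r = 0 → ∀ i, r i ∈ maximalIdeal R := by
  obtain ⟨n, g, hg, hg'⟩ := exists_map_to_quotient_basis (maximalIdeal R • (⊤ : Submodule R M))
    fun r hr x ↦ Submodule.smul_mem_smul hr trivial
  refine ⟨n, g, LinearMap.range_eq_top.1 ?_, fun r hr ↦ (hg' r).1 (by simp [hr])⟩
  refine top_le_iff.1 (Submodule.le_of_le_smul_of_le_jacobson_bot Module.Finite.fg_top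
    (maximalIdeal_le_jacobson _) hg.ge)

end Modules

/-! ### Local rings with 𝔪² = 0: self-injectivity, and recognition of R^α ⊕ k^β. -/

section SquareZero

variable {R : Type u} [CommRing R] [IsLocalRing R]

lemma mul_eq_zero_of_mem_maximalIdeal (hm : maximalIdeal R ^ 2 = ⊥) {a b : R}
    (ha : a ∈ maximalIdeal R) (hb : b ∈ maximalIdeal R) : a * b = 0 := by
  have : a * b ∈ maximalIdeal R ^ 2 := by
    rw [pow_two]
    exact Ideal.mul_mem_mul ha hb
  rwa [hm] at this

lemma exists_maximalIdeal_equiv [IsNoetherianRing R] (hm : maximalIdeal R ^ 2 = ⊥) :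
    ∃ e : ℕ, Nonempty (maximalIdeal R ≃ₗ[R] (Fin e → ResidueField R)) :=
  exists_equiv_residueField _ fun _ hr v ↦
    Subtype.ext (mul_eq_zero_of_mem_maximalIdeal hm hr v.2)

lemma exists_smul_eq_of_le_one {e : ℕ} (he : e ≤ 1) (v w : Fin e → ResidueField R) (hv : v ≠ 0) :
    ∃ c : R, w = c • v := by
  obtain ⟨i, hi⟩ := Function.ne_iff.1 hv
  obtain ⟨c, hc⟩ := residue_surjective (w i / v i)
  have : Subsingleton (Fin e) := ⟨fun a b ↦ by ext; omega⟩
  refine ⟨c, funext fun j ↦ ?_⟩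
  rw [Subsingleton.elim j i, Pi.smul_apply, Algebra.smul_def]
  change w i = residue R c * v i
  rw [hc, div_mul_cancel₀ _ hi]

/-- Baer's criterion: a nonzero proper ideal is all of 𝔪 and is generated by any nonzero element a
of it. -/
lemma isGorenstein_of_le_one (hm : maximalIdeal R ^ 2 = ⊥) {e : ℕ} (he : e ≤ 1)
    (φ : maximalIdeal R ≃ₗ[R] (Fin e → ResidueField R)) : IsGorenstein R := by
  have hbaer : Module.Baer R R := by
    intro I f
    by_cases hI : I = ⊤
    · subst hI
      refine ⟨LinearMap.mulRight R (f ⟨1, trivial⟩), fun x hx ↦ ?_⟩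
      rw [LinearMap.mulRight_apply, ← smul_eq_mul, ← map_smul]
      exact congrArg f (Subtype.ext (mul_one x))
    by_cases hI' : I = ⊥
    · subst hI'
      refine ⟨0, fun x hx ↦ ?_⟩
      have : (⟨x, hx⟩ : (⊥ : Ideal R)) = 0 := Subtype.ext hx
      rw [this, map_zero, LinearMap.zero_apply]
    obtain ⟨a, haI, ha⟩ := Submodule.exists_mem_ne_zero_of_ne_bot hI'
    have hle := le_maximalIdeal hI
    have gen (b : R) (hb : b ∈ maximalIdeal R) : ∃ c, b = c * a := by
      obtain ⟨c, hc⟩ := exists_smul_eq_of_le_one he (φ ⟨a, hle haI⟩) (φ ⟨b, hb⟩) fun h ↦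
        ha (congrArg Subtype.val ((map_eq_zero_iff φ φ.injective).1 h))
      rw [← map_smul] at hc
      exact ⟨c, congrArg Subtype.val (φ.injective hc)⟩
    -- Since a · f(a) = f(a²) = 0 and a ≠ 0, f(a) is not a unit. Hence f(a) = c a, and
    -- multiplication by c extends f.
    have hfa : f ⟨a, haI⟩ ∈ maximalIdeal R := by
      rw [mem_maximalIdeal, mem_nonunits_iff]
      intro hu
      refine ha ((hu.mul_left_eq_zero).1 ?_)
      rw [← smul_eq_mul, ← map_smul]
      have : a • (⟨a, haI⟩ : I) = 0 :=
        Subtype.ext (mul_eq_zero_of_mem_maximalIdeal hm (hle haI) (hle haI))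
      rw [this, map_zero]
    obtain ⟨c, hc⟩ := gen _ hfa
    refine ⟨LinearMap.mulRight R c, fun b hb ↦ ?_⟩
    obtain ⟨d, rfl⟩ := gen b (hle hb)
    have : (⟨d * a, hb⟩ : I) = d • ⟨a, haI⟩ := rfl
    rw [this, map_smul, hc, LinearMap.mulRight_apply, smul_eq_mul]
    ring
  have : Module.Injective R R := hbaer.injective
  have : Injective (ModuleCat.of R R) := (Module.injective_iff_injective_object R R).1 this
  have h : injectiveDimension (ModuleCat.of R R) ≤ (0 : ℕ) :=
    (injectiveDimension_le_iff _ _).2 inferInstance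
  exact h.trans_lt (by exact WithBot.coe_lt_coe.2 (ENat.natCast_lt_top 0))

/-- The family `t` is a basis of the square-zero maximal ideal over the residue field. -/
structure IsResidueBasis {e : ℕ} (t : Fin e → R) : Prop where
  mem : ∀ i, t i ∈ maximalIdeal R
  exists_eq_sum : ∀ r ∈ maximalIdeal R, ∃ c : Fin e → R, r = ∑ i, c i * t i
  mem_of_sum_eq_zero : ∀ c : Fin e → R, ∑ i, c i * t i = 0 → ∀ i, c i ∈ maximalIdeal R

lemma exists_isResidueBasis {e : ℕ} (φ : maximalIdeal R ≃ₗ[R] (Fin e → ResidueField R)) :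
    ∃ t : Fin e → R, IsResidueBasis t := by
  have key (c : Fin e → R) : (φ.symm (residuePi R e c) : R) =
      ∑ i, c i * (φ.symm (Pi.single i 1) : R) := by
    have : residuePi R e c = ∑ i, c i • (Pi.single i 1 : Fin e → ResidueField R) := by
      funext j
      simp [Finset.sum_apply, Pi.single_apply, Algebra.smul_def]
      rfl
    rw [this, map_sum, AddSubmonoidClass.coe_finsetSum]
    refine Finset.sum_congr rfl fun i _ ↦ ?_
    rw [map_smul]
    rfl
  refine ⟨fun i ↦ φ.symm (Pi.single i 1), fun i ↦ (φ.symm _).2, fun r hr ↦ ?_, fun c hc ↦ ?_⟩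
  · obtain ⟨c, hc⟩ := residuePi_surjective e (φ ⟨r, hr⟩)
    exact ⟨c, by rw [← key, hc, φ.symm_apply_apply]⟩
  · rw [← residuePi_eq_zero_iff]
    rw [← key] at hc
    exact (map_eq_zero_iff φ.symm φ.symm.injective).1 (Subtype.ext hc)

/-- The relations `∑ tᵢ xᵢ = 0` in `M` are only those among elements killed by the maximal ideal.
When `t` is a basis of the square-zero maximal ideal, this characterizes the sums of copies of `R`
and `k` among the finitely generated modules. -/
def HasLinearSocle {e : ℕ} (t : Fin e → R) (M : Type*) [AddCommGroup M] [Module R M] : Prop :=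
  ∀ x : Fin e → M, ∑ i, t i • x i = 0 → ∀ i, ∀ r ∈ maximalIdeal R, r • x i = 0

lemma HasLinearSocle.of_injective {e : ℕ} {t : Fin e → R} {M N : Type*} [AddCommGroup M]
    [Module R M] [AddCommGroup N] [Module R N] (h : HasLinearSocle t N) (f : M →ₗ[R] N)
    (hf : Function.Injective f) : HasLinearSocle t M := fun x hx i r hr ↦ by
  have := h (fun i ↦ f (x i)) (by simp only [← map_smul, ← map_sum, hx, map_zero]) i r hr
  rw [← map_smul] at this
  exact (map_eq_zero_iff f hf).1 this

lemma IsResidueBasis.hasLinearSocle_pi (hm : maximalIdeal R ^ 2 = ⊥) {e : ℕ} {t : Fin e → R}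
    (ht : IsResidueBasis t) (n : ℕ) : HasLinearSocle t (Fin n → R) := fun x hx i r hr ↦ by
  funext j
  refine mul_eq_zero_of_mem_maximalIdeal hm hr (ht.mem_of_sum_eq_zero (fun i ↦ x i j) ?_ i)
  have := congrFun hx j
  simpa [Finset.sum_apply, mul_comm] using this

/-- The submodule of elements killed by the maximal ideal. -/
def socle (R : Type u) [CommRing R] [IsLocalRing R] (M : Type*) [AddCommGroup M] [Module R M] :
    Submodule R M where
  carrier := {x | ∀ r ∈ maximalIdeal R, r • x = 0}
  add_mem' hx hy r hr := by rw [smul_add, hx r hr, hy r hr, add_zero]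
  zero_mem' r _ := smul_zero r
  smul_mem' c x hx r hr := by rw [smul_comm, hx r hr, smul_zero]

/-- A basis of M modulo its socle spans a free submodule, and the socle is semisimple, so whatever
part of it that submodule misses splits off as copies of k. -/
lemma HasLinearSocle.exists_equiv [IsNoetherianRing R] (hm : maximalIdeal R ^ 2 = ⊥) {e : ℕ}
    {t : Fin e → R} (ht : IsResidueBasis t) {M : Type*} [AddCommGroup M] [Module R M]
    [Module.Finite R M] (h : HasLinearSocle t M) :
    ∃ α β : ℕ, Nonempty (M ≃ₗ[R] (Fin α → R) × (Fin β → ResidueField R)) := by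
  obtain ⟨n, g, hg, hg'⟩ := exists_map_to_quotient_basis (socle R M) fun r hr x s hs ↦ by
    rw [smul_smul, mul_eq_zero_of_mem_maximalIdeal hm hs hr, zero_smul]
  have hinj : Function.Injective g := by
    refine (injective_iff_map_eq_zero g).2 fun r hr ↦ ?_
    -- A kernel element r has entries in 𝔪, so r = ∑ tⱼ cⱼ with vectors cⱼ. Then ∑ tⱼ g(cⱼ) = 0 puts
    -- each g(cⱼ) in the socle, so cⱼ has entries in 𝔪 and r = 0.
    choose c hc using fun i ↦ ht.exists_eq_sum (r i) ((hg' r).1 (hr ▸ zero_mem _) i)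
    have hsum : ∑ j, t j • g (fun i ↦ c i j) = 0 := by
      simp only [← map_smul, ← map_sum]
      rw [← hr]
      congr 1
      funext i
      rw [hc i, Finset.sum_apply]
      exact Finset.sum_congr rfl fun j _ ↦ mul_comm _ _
    funext i
    rw [hc i]
    refine Finset.sum_eq_zero fun j _ ↦ mul_eq_zero_of_mem_maximalIdeal hm ?_ (ht.mem j)
    exact (hg' fun i ↦ c i j).1 (h _ hsum j) i
  have := isSemisimpleModule_of_smul_eq_zero (R := R) (socle R M)
    fun r hr v ↦ Subtype.ext (v.2 r hr)
  obtain ⟨V, hV⟩ := exists_isCompl ((LinearMap.range g).comap (socle R M).subtype)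
  have hcompl : IsCompl (LinearMap.range g) (V.map (socle R M).subtype) := by
    refine ⟨Submodule.disjoint_def.2 ?_, codisjoint_iff.2 (eq_top_iff.2 fun x _ ↦ ?_)⟩
    · rintro _ hx ⟨v, hv, rfl⟩
      have := Submodule.disjoint_def.1 hV.disjoint v hx hv
      rw [this, map_zero]
    · obtain ⟨y, hy, z, hz, rfl⟩ := Submodule.mem_sup.1 (hg.ge (trivial : x ∈ ⊤))
      obtain ⟨p, hp, v, hv, hpv⟩ := Submodule.mem_sup.1
        (hV.sup_eq_top.ge (trivial : (⟨z, hz⟩ : socle R M) ∈ ⊤))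
      have hz' : z = p.1 + v.1 := (congrArg Subtype.val hpv).symm
      rw [hz', ← add_assoc]
      exact Submodule.add_mem_sup (add_mem hy hp) ⟨v, hv, rfl⟩
  obtain ⟨β, ⟨ψ⟩⟩ := exists_equiv_residueField (R := R) (V.map (socle R M).subtype) <| by
    rintro r hr ⟨_, v, hv, rfl⟩
    exact Subtype.ext (v.2 r hr)
  exact ⟨n, β, ⟨(Submodule.prodEquivOfIsCompl _ _ hcompl).symm ≪≫ₗ
    ((LinearEquiv.ofInjective g hinj).symm.prodCongr ψ)⟩⟩

end SquareZero

/-! ### From exact sequences of linear maps to short complexes. -/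

section ExactSequences

lemma ShortExactSeq.exists_shortComplex {R : Type u} [CommRing R] {A B C : ModuleCat.{u} R}
    (h : ShortExactSeq R A B C) : ∃ S : ShortComplex (ModuleCat.{u} R),
      S.ShortExact ∧ S.X₁ = A ∧ S.X₂ = B ∧ S.X₃ = C := by
  obtain ⟨f, g, hf, hfg, hg⟩ := h
  let S : ShortComplex (ModuleCat.{u} R) :=
    ⟨ModuleCat.ofHom f, ModuleCat.ofHom g, ModuleCat.hom_ext hfg.linearMap_comp_eq_zero⟩
  have hS : S.Exact :=
    (ShortComplex.ShortExact.moduleCat_exact_iff_function_exact S).2 hfg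
  have : Mono S.f := (ModuleCat.mono_iff_injective _).2 hf
  have : Epi S.g := (ModuleCat.epi_iff_surjective _).2 hg
  exact ⟨S, { exact := hS }, rfl, rfl, rfl⟩

end ExactSequences

/-! ### Eventual vanishing of Ext forces freeness; projective and Gorenstein dimension. -/

section FreeOfExt

universe w

variable {R : Type u} [CommRing R] [IsLocalRing R] [IsNoetherianRing R]

lemma exists_equiv_pi_of_ext_eventually_zero (hR : ¬ IsGorenstein R)
    (hm : maximalIdeal R ^ 2 = ⊥) {Q : Type*} [CommRing Q] [IsLocalRing Q] {C : Type*}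
    [Category* C] [Abelian C] [HasExt.{w} C] [Linear Q C] (F : ModuleCat.{u} R ⥤ C) [F.Additive]
    [Limits.PreservesFiniteLimits F] [Limits.PreservesFiniteColimits F] {Y : C} {c N : ℕ}
    (hF : IsExtCyclic Q (F.obj (ModuleCat.of R R)) Y c) (M : ModuleCat.{u} R) [Module.Finite R M]
    (hM : ∀ i, N ≤ i → Subsingleton (Ext (F.obj M) Y i)) :
    ∃ n : ℕ, Nonempty (M ≃ₗ[R] (Fin n → R)) := by
  obtain ⟨e, ⟨φ⟩⟩ := exists_maximalIdeal_equiv hm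
  have he : 2 ≤ e := by
    by_contra h
    exact hR (isGorenstein_of_le_one hm (by omega) φ)
  obtain ⟨n, g, hg, hg'⟩ := exists_minimal_cover (R := R) M
  -- By minimality the syzygy lies in 𝔪Rⁿ, which 𝔪 annihilates, so it is a power of k.
  obtain ⟨s, ⟨ψ⟩⟩ := exists_equiv_residueField (R := R) (LinearMap.ker g) fun r hr v ↦
    Subtype.ext (funext fun i ↦ mul_eq_zero_of_mem_maximalIdeal hm hr (hg' v v.2 i))
  rcases Nat.eq_zero_or_pos s with rfl | hs
  · refine ⟨n, ⟨(LinearEquiv.ofBijective g ⟨?_, hg⟩).symm⟩⟩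
    refine LinearMap.ker_eq_bot.1 ((Submodule.eq_bot_iff _).2 fun x hx ↦ ?_)
    exact congrArg Subtype.val (ψ.injective (Subsingleton.elim (ψ ⟨x, hx⟩) (ψ 0)))
  let q : R →ₗ[R] ResidueField R := Algebra.linearMap R (ResidueField R)
  have hq : Function.Surjective q := residue_surjective
  have hker : LinearMap.ker q = maximalIdeal R := by
    ext r
    exact residue_eq_zero_iff r
  have h₁ := (LinearMap.shortExact_shortComplexKer hq).map_of_exact F
  have h₂ := (LinearMap.shortExact_shortComplexKer hg).map_of_exact F
  have hU : IsFinitePower (ModuleCat.of R (LinearMap.ker q)) (ModuleCat.of R (ResidueField R)) e :=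
    (isFinitePower_pi R _ e).of_iso
      (LinearEquiv.toModuleIso (φ.symm ≪≫ₗ LinearEquiv.ofEq _ _ hker.symm))
  have hV : IsFinitePower (ModuleCat.of R (LinearMap.ker g)) (ModuleCat.of R (ResidueField R)) s :=
    (isFinitePower_pi R _ s).of_iso (LinearEquiv.toModuleIso ψ.symm)
  have := not_shortExact_of_ext_eventually_zero (Q := Q) h₁ h₂ he hs (hU.map F) (hV.map F)
    ((isFinitePower_pi R R n).map F) hF.subsingleton hF.cyclic hM
  have := hF.nontrivial
  exact absurd ‹Subsingleton _› (not_subsingleton (Ext (F.obj (ModuleCat.of R R)) Y c))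

lemma exists_equiv_pi_of_ext_self (hR : ¬ IsGorenstein R) (hm : maximalIdeal R ^ 2 = ⊥)
    (M : ModuleCat.{u} R) [Module.Finite R M] {N : ℕ}
    (hM : ∀ i, N ≤ i → Subsingleton (Ext M (ModuleCat.of R R) i)) :
    ∃ n : ℕ, Nonempty (M ≃ₗ[R] (Fin n → R)) :=
  exists_equiv_pi_of_ext_eventually_zero hR hm (Q := R) (𝟭 (ModuleCat.{u} R))
    (isExtCyclic_self R) M hM

lemma exists_equiv_pi_of_projectiveDimension (hR : ¬ IsGorenstein R)
    (hm : maximalIdeal R ^ 2 = ⊥) (M : ModuleCat.{u} R) [Module.Finite R M]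
    (hM : projectiveDimension M < ⊤) : ∃ n : ℕ, Nonempty (M ≃ₗ[R] (Fin n → R)) := by
  obtain ⟨n, hn⟩ := (projectiveDimension_ne_top_iff M).1 hM.ne
  exact exists_equiv_pi_of_ext_self hR hm M
    fun i hi ↦ HasProjectiveDimensionLT.subsingleton M (n + 1) i hi _

-- Dimension shifting along the resolution, using Extⁱ(G, R) = 0 for i ≥ 1 and G totally reflexive.
omit [IsLocalRing R] [IsNoetherianRing R] in
lemma HasGResolution.subsingleton_ext {n : ℕ} {M : ModuleCat.{u} R} (h : HasGResolution R n M)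
    {i : ℕ} (hi : n < i) : Subsingleton (Ext M (ModuleCat.of R R) i) := by
  induction n generalizing M i with
  | zero => exact IsTotallyReflexive.ext_self h i hi
  | succ n ih =>
    obtain ⟨N, G, hG, hS, hN⟩ := h
    obtain ⟨S, hS', rfl, rfl, rfl⟩ := hS.exists_shortComplex
    obtain ⟨i, rfl⟩ := Nat.exists_eq_add_of_le' (show 1 ≤ i by omega)
    have := hG.ext_self (i + 1) (by omega)
    have := ih hN (i := i) (by omega)
    refine subsingleton_of_forall_eq 0 fun x ↦ ?_
    obtain ⟨y, rfl⟩ := Ext.contravariant_sequence_exact₃ hS' _ x (Subsingleton.elim _ _)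
      (add_comm 1 i)
    rw [Subsingleton.elim y 0, Ext.comp_zero]

omit [IsLocalRing R] [IsNoetherianRing R] in
lemma exists_equiv_pi_of_subsingleton (M : Type*) [AddCommGroup M] [Module R M]
    (h : Subsingleton M) : ∃ n : ℕ, Nonempty (M ≃ₗ[R] (Fin n → R)) :=
  ⟨0, ⟨LinearEquiv.ofSubsingleton _ _⟩⟩

lemma exists_of_iInf_lt_top {P : ℕ → Prop} (h : (⨅ (n : ℕ) (_ : P n), (n : ℕ∞)) < ⊤) :
    ∃ n, P n := by
  by_contra! hP
  simp [hP] at h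

lemma exists_equiv_pi_of_gorensteinDimension (hR : ¬ IsGorenstein R)
    (hm : maximalIdeal R ^ 2 = ⊥) (M : ModuleCat.{u} R) [Module.Finite R M]
    (hM : gorensteinDimension R M < ⊤) : ∃ n : ℕ, Nonempty (M ≃ₗ[R] (Fin n → R)) := by
  by_cases hs : Subsingleton M
  · exact exists_equiv_pi_of_subsingleton M hs
  rw [gorensteinDimension, if_neg hs] at hM
  obtain ⟨n, hn⟩ := exists_of_iInf_lt_top (WithBot.coe_lt_coe.1 hM)
  exact exists_equiv_pi_of_ext_self hR hm M (N := n + 1) fun i hi ↦ hn.subsingleton_ext hi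

end FreeOfExt

/-! ### Quasi-deformations and complete intersection dimension. -/

section QuasiDeformation

variable {R : Type u} [CommRing R]

namespace QuasiDeformation

variable (D : QuasiDeformation R)

/-- The functor `S ⊗ -` from `R`-modules to `S`-modules attached to a quasi-deformation. -/
noncomputable def tensorFunctor : ModuleCat.{u} R ⥤ ModuleCat.{u} D.S where
  obj M := ModuleCat.of D.S (TensorProduct R D.S M)
  map f := ModuleCat.ofHom (f.hom.baseChange D.S)
  map_id M := by
    rw [ModuleCat.hom_id, LinearMap.baseChange_id]
    rfl
  map_comp f g := by
    rw [ModuleCat.hom_comp, LinearMap.baseChange_comp]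
    rfl

instance : D.tensorFunctor.Additive where
  map_add {_ _ f g} := ModuleCat.hom_ext (LinearMap.baseChange_add f.hom g.hom)

lemma tensorFunctor_map_exact (S : ShortComplex (ModuleCat.{u} R)) (h : S.Exact) :
    (S.map D.tensorFunctor).Exact := by
  rw [ShortComplex.ShortExact.moduleCat_exact_iff_function_exact] at h ⊢
  exact Module.Flat.lTensor_exact D.S h

lemma preservesFinite_tensorFunctor : Limits.PreservesFiniteLimits D.tensorFunctor ∧
    Limits.PreservesFiniteColimits D.tensorFunctor :=
  ((Functor.exact_tfae D.tensorFunctor).out 1 3).1 D.tensorFunctor_map_exact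

instance : Limits.PreservesFiniteLimits D.tensorFunctor :=
  D.preservesFinite_tensorFunctor.1

instance : Limits.PreservesFiniteColimits D.tensorFunctor :=
  D.preservesFinite_tensorFunctor.2

/-- The ring `S` as a `Q`-module. -/
noncomputable abbrev targetModule : ModuleCat.{u} D.Q :=
  (ModuleCat.restrictScalars D.toS).obj (ModuleCat.of D.S D.S)

lemma exists_targetModule_iso : ∃ xs : List D.Q,
    (∀ x ∈ xs, x ∈ maximalIdeal D.Q) ∧ RingTheory.Sequence.IsWeaklyRegular D.Q xs ∧
      Nonempty (ModuleCat.of D.Q (D.Q ⧸ (Ideal.ofList xs • (⊤ : Submodule D.Q D.Q))) ≅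
        D.targetModule) := by
  obtain ⟨xs, hxs, hker⟩ := D.exists_regular
  let f : D.Q →ₗ[D.Q] D.targetModule :=
    { toFun := D.toS
      map_add' := map_add D.toS
      map_smul' := map_mul D.toS }
  have hf : LinearMap.ker f = Ideal.ofList xs • (⊤ : Submodule D.Q D.Q) := by
    rw [smul_eq_mul, Ideal.mul_top, ← hker]
    rfl
  refine ⟨xs, fun x hx ↦ ?_, hxs.toIsWeaklyRegular, ⟨LinearEquiv.toModuleIso
    ((Submodule.quotEquivOfEq _ _ hf.symm) ≪≫ₗ f.quotKerEquivOfSurjective D.surjective)⟩⟩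
  refine le_maximalIdeal (RingHom.ker_ne_top D.toS) ?_
  rw [hker]
  exact Ideal.subset_span hx

lemma exists_isExtCyclic_targetModule :
    ∃ c, IsExtCyclic D.Q D.targetModule (ModuleCat.of D.Q D.Q) c := by
  obtain ⟨xs, hmem, hreg, ⟨i⟩⟩ := D.exists_targetModule_iso
  obtain ⟨c, hc⟩ := (isExtCyclic_self D.Q).quotient xs hmem _ _ hreg
  exact ⟨c, hc.of_iso i⟩

/-- S is Q modulo a regular sequence. Finiteness is needed because `ciDimension` bounds pd_Q(S ⊗ M)
only by n + pd_Q(S). -/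
lemma pd_self_lt_top : D.pd (ModuleCat.of D.S D.S) < ⊤ := by
  obtain ⟨xs, hmem, hreg, ⟨i⟩⟩ := D.exists_targetModule_iso
  change projectiveDimension D.targetModule < ⊤
  rw [← projectiveDimension_eq_of_iso i,
    ModuleCat.projectiveDimension_quotient_eq_add_length_of_isWeaklyRegular
      (ModuleCat.of D.Q D.Q) xs hreg hmem]
  have h : projectiveDimension (ModuleCat.of D.Q D.Q) ≤ (0 : ℕ) :=
    (projectiveDimension_le_iff _ _).2
      (inferInstanceAs (HasProjectiveDimensionLT (ModuleCat.of D.Q D.Q) 1))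
  refine (add_le_add_left h _).trans_lt ?_
  rw [← Nat.cast_add]
  exact WithBot.coe_lt_coe.2 (ENat.natCast_lt_top (0 + xs.length))

end QuasiDeformation

lemma exists_equiv_pi_of_ciDimension [IsLocalRing R] [IsNoetherianRing R]
    (hR : ¬ IsGorenstein R) (hm : maximalIdeal R ^ 2 = ⊥) (M : ModuleCat.{u} R)
    [Module.Finite R M] (hM : ciDimension R M < ⊤) :
    ∃ n : ℕ, Nonempty (M ≃ₗ[R] (Fin n → R)) := by
  by_cases hs : Subsingleton M
  · exact exists_equiv_pi_of_subsingleton M hs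
  rw [ciDimension, if_neg hs] at hM
  obtain ⟨n, D, hD⟩ := exists_of_iInf_lt_top (WithBot.coe_lt_coe.1 hM)
  have hlt : D.pd (ModuleCat.of D.S (TensorProduct R D.S M)) < ⊤ := by
    refine hD.trans_lt ?_
    have h := D.pd_self_lt_top
    revert h
    generalize D.pd (ModuleCat.of D.S D.S) = d
    intro h
    induction d with
    | bot => exact bot_lt_top
    | coe d =>
      have hd : d < ⊤ := WithBot.coe_lt_coe.1 h
      exact WithBot.coe_lt_coe.2 (WithTop.add_lt_top.2 ⟨ENat.natCast_lt_top n, hd⟩)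
  obtain ⟨p, hp⟩ := (projectiveDimension_ne_top_iff _).1 hlt.ne
  obtain ⟨c, hc⟩ := D.exists_isExtCyclic_targetModule
  let F : ModuleCat.{u} R ⥤ ModuleCat.{u} D.Q :=
    D.tensorFunctor ⋙ ModuleCat.restrictScalars D.toS
  have hF : IsExtCyclic D.Q (F.obj (ModuleCat.of R R)) (ModuleCat.of D.Q D.Q) c :=
    hc.of_iso ((ModuleCat.restrictScalars D.toS).mapIso
      (LinearEquiv.toModuleIso (TensorProduct.AlgebraTensorModule.rid R D.S D.S).symm))
  have : Limits.PreservesFiniteLimits F := Limits.comp_preservesFiniteLimits _ _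
  have : Limits.PreservesFiniteColimits F := Limits.comp_preservesFiniteColimits _ _
  have : F.Additive := inferInstanceAs (Functor.Additive (_ ⋙ _))
  exact exists_equiv_pi_of_ext_eventually_zero hR hm F hF M (N := p + 1)
    fun i hi ↦ hp.subsingleton _ _ i hi _

end QuasiDeformation

/-! ### Finiteness of the three dimensions on free modules. -/

section FreeModules

variable (R : Type u) [CommRing R] (M : ModuleCat.{u} R)

lemma projectiveDimension_le_zero_of_free [Module.Free R M] : projectiveDimension M ≤ (0 : ℕ) :=
  have : Projective M := (IsProjective.iff_projective M).1 Module.Projective.of_free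
  (projectiveDimension_le_iff _ _).2 (inferInstanceAs (HasProjectiveDimensionLT M 1))

lemma projectiveDimension_lt_top_of_free [Module.Free R M] : projectiveDimension M < ⊤ :=
  (projectiveDimension_le_zero_of_free R M).trans_lt
    (WithBot.coe_lt_coe.2 (ENat.natCast_lt_top 0))

lemma isTotallyReflexive_of_free [Module.Finite R M] [Module.Free R M] :
    IsTotallyReflexive R M := by
  have : Projective M := (IsProjective.iff_projective M).1 Module.Projective.of_free
  have : Projective (ModuleCat.of R (Module.Dual R M)) :=
    (IsProjective.iff_projective _).1 inferInstance
  exact ⟨inferInstance, inferInstance, fun i hi ↦ HasProjectiveDimensionLT.subsingleton _ 1 i hi _,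
    fun i hi ↦ HasProjectiveDimensionLT.subsingleton _ 1 i hi _⟩

lemma iInf_lt_top_of_exists {P : ℕ → Prop} {n : ℕ} (h : P n) :
    (⨅ (n : ℕ) (_ : P n), (n : ℕ∞)) < ⊤ :=
  (iInf₂_le n h).trans_lt (ENat.natCast_lt_top n)

lemma gorensteinDimension_lt_top_of_free [Module.Finite R M] [Module.Free R M] :
    gorensteinDimension R M < ⊤ := by
  rw [gorensteinDimension]
  split_ifs
  · exact bot_lt_top
  · exact WithBot.coe_lt_coe.2 (iInf_lt_top_of_exists (n := 0) (isTotallyReflexive_of_free R M))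

/-- The quasi-deformation `R → R ← R`. -/
def QuasiDeformation.trivial [IsLocalRing R] [IsNoetherianRing R] : QuasiDeformation R where
  S := R
  Q := R
  isLocalHom := inferInstanceAs (IsLocalHom (RingHom.id R))
  toS := RingHom.id R
  surjective := Function.surjective_id
  exists_regular := ⟨[], ⟨RingTheory.Sequence.IsWeaklyRegular.nil R R, by
    rw [Ideal.ofList_nil, Submodule.bot_smul]
    exact top_ne_bot⟩, by
    rw [Ideal.ofList_nil]
    exact (RingHom.injective_iff_ker_eq_bot _).1 Function.injective_id⟩

lemma ciDimension_lt_top_of_free [IsLocalRing R] [IsNoetherianRing R] [Module.Free R M] :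
    ciDimension R M < ⊤ := by
  rw [ciDimension]
  split_ifs
  · exact bot_lt_top
  refine WithBot.coe_lt_coe.2 (iInf_lt_top_of_exists (n := 0)
    ⟨QuasiDeformation.trivial R, ?_⟩)
  have h₁ : Module.Free R ((ModuleCat.restrictScalars (RingHom.id R)).obj
      (ModuleCat.of R (TensorProduct R R M))) :=
    inferInstanceAs (Module.Free R (TensorProduct R R M))
  -- The zero module has projective dimension `⊥`, so this bound uses that R is nontrivial.
  have h₂ : (0 : WithBot ℕ∞) ≤ projectiveDimension
      ((ModuleCat.restrictScalars (RingHom.id R)).obj (ModuleCat.of R R)) := by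
    refine (projectiveDimension_ge_iff _ 0).2 fun h ↦ ?_
    have : Subsingleton R := ModuleCat.isZero_iff_subsingleton.1
      ((hasProjectiveDimensionLT_zero_iff_isZero _).1 h)
    exact not_subsingleton R this
  rw [Nat.cast_zero, zero_add]
  exact (@projectiveDimension_le_zero_of_free R _ _ h₁).trans h₂

end FreeModules

/-! ### Reducing sequences: descent to M, and the explicit sequence of length one. -/

section Reducing

variable {R : Type u} [CommRing R] [IsLocalRing R]

lemma IsReducingSequence.hasLinearSocle {H : ModuleCat.{u} R → WithBot ℕ∞} {M : ModuleCat.{u} R}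
    {r : ℕ} {K : Fin (r + 1) → ModuleCat.{u} R} (hK : IsReducingSequence R H M r K) {e : ℕ}
    {t : Fin e → R} (h : HasLinearSocle t (K (Fin.last r))) : HasLinearSocle t M := by
  have key (i : Fin (r + 1)) : HasLinearSocle t (K i) := by
    induction i using Fin.reverseInduction with
    | last => exact h
    | cast i ih =>
      obtain ⟨a, -, -, ha, -, -, N, -, f, -, hf, -, -⟩ := hK.step i
      refine ih.of_injective (f ∘ₗ LinearMap.single R (fun _ ↦ K i.castSucc) ⟨0, ha⟩)
        fun x y hxy ↦ ?_
      simpa using congrFun (hf hxy) ⟨0, ha⟩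
  have := key 0
  rwa [hK.zero_eq] at this

lemma exists_equiv_of_reducing_lt_top [IsNoetherianRing R] (hm : maximalIdeal R ^ 2 = ⊥)
    {H : ModuleCat.{u} R → WithBot ℕ∞}
    (hH : ∀ K : ModuleCat.{u} R, Module.Finite R K → H K < ⊤ →
      ∃ n : ℕ, Nonempty (K ≃ₗ[R] (Fin n → R)))
    (M : ModuleCat.{u} R) [Module.Finite R M] (hM : reducing R H M < ⊤) :
    ∃ α β : ℕ, Nonempty (M ≃ₗ[R] (Fin α → R) × (Fin β → ResidueField R)) := by
  obtain ⟨r, K, hK⟩ := exists_of_iInf_lt_top hM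
  obtain ⟨n, ⟨φ⟩⟩ := hH _ (hK.finite _) hK.last_lt
  obtain ⟨e, ⟨ψ⟩⟩ := exists_maximalIdeal_equiv hm
  obtain ⟨t, ht⟩ := exists_isResidueBasis ψ
  exact HasLinearSocle.exists_equiv hm ht (hK.hasLinearSocle
    ((ht.hasLinearSocle_pi hm n).of_injective φ.toLinearMap φ.injective))

/-- The linear equivalence between functions into a product and pairs of functions. -/
def piProdEquiv (R ι A B : Type*) [Semiring R] [AddCommMonoid A] [Module R A] [AddCommMonoid B]
    [Module R B] : (ι → A × B) ≃ₗ[R] (ι → A) × (ι → B) :=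
  (Equiv.arrowProdEquivProdArrow ι (fun _ ↦ A) (fun _ ↦ B)).toLinearEquiv
    ⟨fun _ _ ↦ rfl, fun _ _ ↦ rfl⟩

/-- The minimal cover of R^α ⊕ k^β is the identity on R^α and reduction on R^β, with kernel 𝔪^β. -/
lemma isFirstSyzygy_of_equiv {M : ModuleCat.{u} R} {α β : ℕ}
    (ψ : M ≃ₗ[R] (Fin α → R) × (Fin β → ResidueField R)) :
    IsFirstSyzygy R M (ModuleCat.of R (Fin β → maximalIdeal R)) := by
  let E : (Fin (α + β) → R) ≃ₗ[R] (Fin α → R) × (Fin β → R) :=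
    LinearEquiv.funCongrLeft R R finSumFinEquiv ≪≫ₗ LinearEquiv.sumArrowLequivProdArrow _ _ R R
  let f₀ : (Fin β → maximalIdeal R) →ₗ[R] (Fin β → R) :=
    LinearMap.pi fun i ↦ (maximalIdeal R).subtype ∘ₗ LinearMap.proj i
  let f : (Fin β → maximalIdeal R) →ₗ[R] (Fin (α + β) → R) :=
    E.symm.toLinearMap ∘ₗ LinearMap.inr R _ _ ∘ₗ f₀
  let g : (Fin (α + β) → R) →ₗ[R] M :=
    ψ.symm.toLinearMap ∘ₗ (LinearMap.id.prodMap (residuePi R β)) ∘ₗ E.toLinearMap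
  have hf₀ : Function.Injective f₀ := fun v w h ↦
    funext fun i ↦ Subtype.ext (congrFun h i)
  have hfg : Function.Exact f g := fun x ↦ by
    have h1 : g x = 0 ↔ (E x).1 = 0 ∧ residuePi R β (E x).2 = 0 := by
      change ψ.symm ((E x).1, residuePi R β (E x).2) = 0 ↔ _
      rw [map_eq_zero_iff _ ψ.symm.injective, Prod.mk_eq_zero]
    rw [h1, residuePi_eq_zero_iff]
    constructor
    · rintro ⟨h2, h3⟩
      refine ⟨fun i ↦ ⟨(E x).2 i, h3 i⟩, ?_⟩
      change E.symm (0, (E x).2) = x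
      rw [← h2, Prod.mk.eta, E.symm_apply_apply]
    · rintro ⟨v, rfl⟩
      have : E (f v) = (0, f₀ v) := E.apply_symm_apply _
      rw [this]
      exact ⟨rfl, fun i ↦ (v i).2⟩
  refine ⟨α + β, f, g, E.symm.injective.comp (LinearMap.inr_injective.comp hf₀), hfg, ?_, ?_⟩
  · exact ψ.symm.surjective.comp
      ((Function.surjective_id.prodMap (residuePi_surjective β)).comp E.surjective)
  · intro x hx
    obtain ⟨v, rfl⟩ := (hfg x).1 hx
    have : f₀ v = ∑ i, (v i : R) • Pi.single i 1 := by
      funext j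
      simp [f₀, Finset.sum_apply, Pi.single_apply]
    change E.symm (LinearMap.inr R _ _ (f₀ v)) ∈ _
    rw [this]
    simp only [map_sum, map_smul]
    exact Submodule.sum_mem _ fun i _ ↦ Submodule.smul_mem_smul (v i).2 trivial

/-- Since 𝔪 ≅ k^e, the non-free part k^{βe²} of M^{e²} is 𝔪^{βe} inside R^{βe}, with quotient k^{βe}
≅ 𝔪^β = ΩM. The free part of M^{e²} is carried along unchanged. -/
lemma shortExactSeq_of_equiv {M : ModuleCat.{u} R} {α β e : ℕ}
    (φ : maximalIdeal R ≃ₗ[R] (Fin e → ResidueField R))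
    (ψ : M ≃ₗ[R] (Fin α → R) × (Fin β → ResidueField R)) :
    ShortExactSeq R (Fin (e * e) → M) ((Fin (e * e) → Fin α → R) × (Fin β → Fin e → R))
      (Fin 1 → Fin β → maximalIdeal R) := by
  -- Splits the index e² as e × e: one factor e is absorbed by k^e ≅ 𝔪, the other counts copies of
  -- 𝔪.
  let θ : (Fin (e * e) → Fin β → ResidueField R) ≃ₗ[R] (Fin β → Fin e → maximalIdeal R) :=
    (LinearEquiv.curry R (ResidueField R) (Fin (e * e)) (Fin β)).symm ≪≫ₗ
    LinearEquiv.funCongrLeft R (ResidueField R)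
      ((Equiv.prodComm _ _).trans (finProdFinEquiv.prodCongr (Equiv.refl (Fin β)))) ≪≫ₗ
    LinearEquiv.curry R (ResidueField R) (Fin β) (Fin e × Fin e) ≪≫ₗ
    LinearEquiv.piCongrRight fun _ ↦ LinearEquiv.curry R (ResidueField R) (Fin e) (Fin e) ≪≫ₗ
      LinearEquiv.piCongrRight fun _ ↦ φ.symm
  let E : (Fin (e * e) → M) ≃ₗ[R] (Fin (e * e) → Fin α → R) × (Fin β → Fin e → maximalIdeal R) :=
    LinearEquiv.piCongrRight (fun _ ↦ ψ) ≪≫ₗ piProdEquiv R _ _ _ ≪≫ₗ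
      (LinearEquiv.refl R _).prodCongr θ
  let f₀ : (Fin β → Fin e → maximalIdeal R) →ₗ[R] (Fin β → Fin e → R) :=
    LinearMap.pi fun i ↦ LinearMap.pi fun j ↦
      (maximalIdeal R).subtype ∘ₗ LinearMap.proj j ∘ₗ LinearMap.proj i
  let g₀ : (Fin β → Fin e → R) →ₗ[R] (Fin β → Fin e → ResidueField R) :=
    LinearMap.pi fun i ↦ residuePi R e ∘ₗ LinearMap.proj i
  let E' : (Fin β → Fin e → ResidueField R) ≃ₗ[R] (Fin 1 → Fin β → maximalIdeal R) :=
    LinearEquiv.piCongrRight (fun _ ↦ φ.symm) ≪≫ₗ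
      (LinearEquiv.funUnique (Fin 1) R (Fin β → maximalIdeal R)).symm
  have hf₀ : Function.Injective f₀ := fun v w h ↦
    funext fun i ↦ funext fun j ↦ Subtype.ext (congrFun (congrFun h i) j)
  have hg₀ : Function.Surjective g₀ := fun v ↦ by
    choose x hx using fun i ↦ residuePi_surjective e (v i)
    exact ⟨x, funext hx⟩
  have h₀ : Function.Exact f₀ g₀ := fun x ↦ by
    constructor
    · intro hx
      exact ⟨fun i j ↦ ⟨x i j, (residuePi_eq_zero_iff _).1 (congrFun hx i) j⟩, rfl⟩
    · rintro ⟨v, rfl⟩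
      exact funext fun i ↦ (residuePi_eq_zero_iff _).2 fun j ↦ (v i j).2
  refine ⟨(LinearMap.id.prodMap f₀) ∘ₗ E.toLinearMap,
    E'.toLinearMap ∘ₗ g₀ ∘ₗ LinearMap.snd R _ _, ?_, fun x ↦ ?_, ?_⟩
  · exact (Function.injective_id.prodMap hf₀).comp E.injective
  · change E' (g₀ x.2) = 0 ↔ _
    rw [map_eq_zero_iff _ E'.injective, h₀]
    constructor
    · rintro ⟨v, hv⟩
      refine ⟨E.symm (x.1, v), ?_⟩
      change Prod.map id f₀ (E (E.symm (x.1, v))) = x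
      rw [E.apply_symm_apply]
      exact Prod.ext rfl hv
    · rintro ⟨y, rfl⟩
      exact ⟨(E y).2, rfl⟩
  · exact E'.surjective.comp (hg₀.comp Prod.snd_surjective)

lemma reducing_le_one_of_equiv {H : ModuleCat.{u} R → WithBot ℕ∞}
    (hH : ∀ K : ModuleCat.{u} R, Module.Finite R K → Module.Free R K → H K < ⊤) {e : ℕ}
    (he : 0 < e) (φ : maximalIdeal R ≃ₗ[R] (Fin e → ResidueField R)) {M : ModuleCat.{u} R}
    [Module.Finite R M] {α β : ℕ} (ψ : M ≃ₗ[R] (Fin α → R) × (Fin β → ResidueField R)) :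
    reducing R H M ≤ 1 := by
  let K : ModuleCat.{u} R := ModuleCat.of R ((Fin (e * e) → Fin α → R) × (Fin β → Fin e → R))
  have hK : Module.Finite R K := inferInstanceAs
    (Module.Finite R ((Fin (e * e) → Fin α → R) × (Fin β → Fin e → R)))
  have hK' : Module.Free R K := inferInstanceAs
    (Module.Free R ((Fin (e * e) → Fin α → R) × (Fin β → Fin e → R)))
  refine iInf₂_le_of_le 1 ⟨![M, K], ?_, rfl, hH K hK hK', ?_⟩ (by simp)
  · intro i
    fin_cases i
    · assumption
    · exact hK
  · intro i
    fin_cases i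
    exact ⟨e * e, 1, 1, by positivity, one_pos, one_pos, _,
      ⟨_, isFirstSyzygy_of_equiv ψ, ⟨LinearEquiv.refl _ _⟩⟩, shortExactSeq_of_equiv φ ψ⟩

end Reducing

end ReducingDim

theorem proposition2p5 (R : Type u) [CommRing R] [IsLocalRing R] [IsNoetherianRing R]
    (hR : ¬ ReducingDim.IsGorenstein R) (hm : IsLocalRing.maximalIdeal R ^ 2 = ⊥)
    (M : ModuleCat.{u} R) [Module.Finite R M] :
    List.TFAE
      [∃ α β : ℕ, Nonempty
          (M ≃ₗ[R] (Fin α → R) × (Fin β → IsLocalRing.ResidueField R)),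
        ReducingDim.reducingPD R M < ⊤,
        ReducingDim.reducingPD R M ≤ 1,
        ReducingDim.reducingCIDim R M < ⊤,
        ReducingDim.reducingCIDim R M ≤ 1,
        ReducingDim.reducingGDim R M < ⊤,
        ReducingDim.reducingGDim R M ≤ 1] := by
  have hlt {d : ℕ∞} (h : d ≤ 1) : d < ⊤ := h.trans_lt (ENat.natCast_lt_top 1)
  obtain ⟨e, ⟨φ⟩⟩ := ReducingDim.exists_maximalIdeal_equiv hm
  -- Positivity of e makes the multiplicity a = e² of the reducing sequence positive.
  have he : 0 < e := Nat.pos_of_ne_zero fun h ↦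
    hR (ReducingDim.isGorenstein_of_le_one hm (by omega) φ)
  tfae_have 1 → 3 := fun ⟨_, _, ⟨ψ⟩⟩ ↦ ReducingDim.reducing_le_one_of_equiv
    (fun K _ _ ↦ ReducingDim.projectiveDimension_lt_top_of_free R K) he φ ψ
  tfae_have 1 → 5 := fun ⟨_, _, ⟨ψ⟩⟩ ↦ ReducingDim.reducing_le_one_of_equiv
    (fun K _ _ ↦ ReducingDim.ciDimension_lt_top_of_free R K) he φ ψ
  tfae_have 1 → 7 := fun ⟨_, _, ⟨ψ⟩⟩ ↦ ReducingDim.reducing_le_one_of_equiv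
    (fun K _ _ ↦ ReducingDim.gorensteinDimension_lt_top_of_free R K) he φ ψ
  tfae_have 3 → 2 := hlt
  tfae_have 5 → 4 := hlt
  tfae_have 7 → 6 := hlt
  tfae_have 2 → 1 := ReducingDim.exists_equiv_of_reducing_lt_top hm
    (fun K _ ↦ ReducingDim.exists_equiv_pi_of_projectiveDimension hR hm K) M
  tfae_have 4 → 1 := ReducingDim.exists_equiv_of_reducing_lt_top hm
    (fun K _ ↦ ReducingDim.exists_equiv_pi_of_ciDimension hR hm K) M
  tfae_have 6 → 1 := ReducingDim.exists_equiv_of_reducing_lt_top hm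
    (fun K _ ↦ ReducingDim.exists_equiv_pi_of_gorensteinDimension hR hm K) M
  tfae_finish
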